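/- Let $m\ge 2$ be an integer, $n=2m$, $\delta\in\mathbb F_{2^n}$, and let $$F(X)=(X^{2^m}+X+\delta)^{2^{2m-2}+2^{m-2}+1}+X\in\mathbb F_{2^n}[X],$$ regarded as a function $\mathbb F_{2^n}\to\mathbb F_{2^n}$. For $c\in\mathbb F_{2^n}$, the $c$-differential uniformity of $F$ is the maximum, over all $a,b\in\mathbb F_{2^n}$ (with $a\neq 0$ if $c=1$), of the number of $x\in\mathbb F_{2^n}$ with $F(x+a)-cF(x)=b$. The function $F$ is called P$c$N (perfect $c$-nonlinear) if its $c$-differential uniformity equals $1$, and AP$c$N (almost perfect $c$-nonlinear) if it equals $2$. Write $\bar\delta=\delta^{2^m}$, let $\mathrm{Tr}_1^{k}(x)=\sum_{i=0}^{k-1}x^{2^i}$ be the absolute trace $\mathbb F_{2^k}\to\mathbb F_2$, and let the polynomials $p_k$ be defined by $p_1(X)=p_2(X)=X$ and $p_k(X)=p_{k-1}(X)+X^{2^{k-3}}p_{k-2}(X)$ for $k\ge 3$. (1) If $\delta\in\mathbb F_{2^m}$, then $F$ is P$c$N for every $c\in\mathbb F_{2^m}\setminus\{1\}$ and AP$c$N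 for every $c\in\mathbb F_{2^n}\setminus\mathbb F_{2^m}$. (2) If $\delta\in\mathbb F_{2^n}\setminus\mathbb F_{2^m}$, $\mathrm{Tr}_1^{2m}(\delta)=\mathrm{Tr}_1^m(1)$ and $p_m((\delta+\bar\delta)^{-1})\neq 0$, then $F$ is P$c$N for every $c\in\mathbb F_{2^m}\setminus\{1\}$, and the $c$-differential uniformity of $F$ is at most $4$ for every $c\in\mathbb F_{2^n}\setminus\mathbb F_{2^m}$. -/

import Mathlib

open Polynomial

/-- The multiplicative `c`-derivative of `F` with respect to `a`: `x ↦ F (x + a) - c F x`. -/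
def cDerivative {L : Type*} [Field L] (F : L → L) (c a x : L) : L :=
  F (x + a) - c * F x

/-- The entry of the `c`-difference distribution table of `F` at `(a, b)`: the number of solutions
`x` of `F (x + a) - c F x = b`. -/
noncomputable def cDDT {L : Type*} [Field L] (F : L → L) (c a b : L) : ℕ :=
  Nat.card {x : L // cDerivative F c a x = b}

/-- The `c`-differential uniformity of `F`: the maximum of the `c`-DDT entries over all `a, b`, with
`a ≠ 0` if `c = 1`. Over a finite field this is the supremum of a nonempty finite set of naturals,
so it is attained. -/
noncomputable def cDifferentialUniformity {L : Type*} [Field L] (F : L → L) (c : L) : ℕ :=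
  sSup {k : ℕ | ∃ a b : L, (c = 1 → a ≠ 0) ∧ k = cDDT F c a b}

/-- `F` is perfect `c`-nonlinear. -/
def IsPcN {L : Type*} [Field L] (F : L → L) (c : L) : Prop :=
  cDifferentialUniformity F c = 1

/-- `F` is almost perfect `c`-nonlinear. -/
def IsAPcN {L : Type*} [Field L] (F : L → L) (c : L) : Prop :=
  cDifferentialUniformity F c = 2

/-- The polynomials `p_1 = p_2 = X`, `p_k = p_{k-1} + X^{2^{k-3}} p_{k-2}` for `k ≥ 3`.
(The value at index `0` plays no role in the recursion.) -/
noncomputable def cubicPoly (L : Type*) [Field L] : ℕ → L[X]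
  | 0 => 0
  | 1 => X
  | 2 => X
  | k + 3 => cubicPoly L (k + 2) + X ^ (2 ^ k) * cubicPoly L (k + 1)

/-- The polynomial `(X^{2^m} + X + δ)^{2^{2m-2} + 2^{m-2} + 1} + X` (meant for `m ≥ 2`). -/
noncomputable def permPoly {L : Type*} [Field L] (m : ℕ) (δ : L) : L[X] :=
  (X ^ (2 ^ m) + X + C δ) ^ (2 ^ (2 * m - 2) + 2 ^ (m - 2) + 1) + X

/-! ### The cubic `Y ^ 3 + Y + A` in characteristic 2 -/

section Cubic

/-! Let `σ` be the conjugation `x ↦ x ^ 2 ^ m` and `ρ` the inverse of the fourth power. With `y = x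
+ σ x + δ`, the function is `x + ρ (y * σ y) * y`. The increments of `ρ (y * σ y)` are additive in
`x + σ x`, so the difference `w` of two solutions of a `c`-differential equation is an explicit
function of `U = w + σ w`. Adding the conjugate gives, for `z = ρ U`, an equation `k₄ z ^ 4 + k₂ z ^
2 + k₂ t z = 0` (`linearized_eq_zero`), where `T = δ + σ δ`, `t = ρ T`, and the coefficients depend
only on `a`, `c`, `δ`. Counting solutions thus becomes counting roots `z`.

If `c` is in the subfield, the equation is `z ^ 4 + T z ^ 2 + T t z = 0`, and uniqueness means that
it has no nonzero root in the subfield. This is clear for `T = 0`. Otherwise a nonzero root rescales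
to a root of `Y ^ 3 + Y + T⁻¹`; the trace condition then makes the cubic split over the subfield,
which forces `p_m (T⁻¹) = 0`.

For other `c` the polynomial is nonzero, which gives the bound 4. If `T = 0` it is quadratic in `z ^
2`, which gives the bound 2, and a suitable `a` attains it. -/

theorem cubicPoly_map {L M : Type*} [Field L] [Field M] (f : L →+* M) (k : ℕ) :
    (cubicPoly L k).map f = cubicPoly M k := by
  induction k using cubicPoly.induct with
  | case1 => simp [cubicPoly]
  | case2 => simp [cubicPoly]
  | case3 => simp [cubicPoly]
  | case4 k h₁ h₂ => simp [cubicPoly, h₁, h₂]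

/-- Powers `y ^ 2 ^ k` of the roots of `Y ^ 3 + Y + A` are linear combinations of `y ^ 2` and `y`,
the coefficient of `y ^ 2` being given by `cubicPoly`. -/
theorem exists_root_pow_two_pow {L : Type*} [Field L] [CharP L 2] (A : L) (k : ℕ) :
    ∃ r : L, ∀ y : L, y ^ 3 + y + A = 0 →
      A ^ 2 * y ^ 2 ^ k = (cubicPoly L k).eval A ^ 2 * y ^ 2 + r * y := by
  have h2 : (2 : L) = 0 := CharTwo.two_eq_zero
  induction k using cubicPoly.induct with
  | case1 => exact ⟨A ^ 2, fun y _ => by simp [cubicPoly]⟩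
  | case2 => exact ⟨0, fun y _ => by simp [cubicPoly]⟩
  | case3 =>
    refine ⟨A ^ 3, fun y hy => ?_⟩
    simp only [cubicPoly, eval_X]
    linear_combination A ^ 2 * y * hy - (A ^ 2 * y ^ 2 + A ^ 3 * y) * h2
  | case4 k h₁ h₂ =>
    obtain ⟨r₁, hr₁⟩ := h₁
    obtain ⟨r₂, hr₂⟩ := h₂
    refine ⟨r₁ + A ^ 2 ^ (k + 1) * r₂, fun y hy => ?_⟩
    -- Raising this relation to the power `2 ^ (k + 1)` produces the recursion of `cubicPoly`,
    -- squared.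
    have h4 : y ^ 4 = y ^ 2 + A * y := by
      linear_combination y * hy - (y ^ 2 + A * y) * h2
    have hpow : y ^ 2 ^ (k + 3) = y ^ 2 ^ (k + 2) + A ^ 2 ^ (k + 1) * y ^ 2 ^ (k + 1) := by
      have e₁ : y ^ 2 ^ (k + 3) = (y ^ 4) ^ 2 ^ (k + 1) := by rw [← pow_mul]; congr 1; ring
      have e₂ : y ^ 2 ^ (k + 2) = (y ^ 2) ^ 2 ^ (k + 1) := by rw [← pow_mul]; congr 1; ring
      rw [e₁, e₂, h4, add_pow_char_pow, mul_pow]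
    have hsq : (A ^ 2 ^ k) ^ 2 = A ^ 2 ^ (k + 1) := by rw [← pow_mul]; congr 1
    rw [hpow]
    simp only [cubicPoly, eval_add, eval_mul, eval_pow, eval_X]
    rw [CharTwo.add_sq, mul_pow, hsq]
    linear_combination hr₁ y hy + A ^ 2 ^ (k + 1) * hr₂ y hy

theorem sum_sq_add_self_pow_two_pow {L : Type*} [Field L] [CharP L 2] (v : L) (m : ℕ) :
    ∑ i ∈ Finset.range m, (v ^ 2 + v) ^ 2 ^ i = v ^ 2 ^ m + v := by
  induction m with
  | zero => simp [CharTwo.add_self_eq_zero]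
  | succ m ih =>
    rw [Finset.sum_range_succ, ih, add_pow_char_pow, ← pow_mul, ← pow_succ']
    linear_combination v ^ 2 ^ m * (CharTwo.two_eq_zero : (2 : L) = 0)

/-- The other roots are `v * y` and `(v + 1) * y` with `v ^ 2 + v = 1 + 1 / y ^ 2`; the closure
supplies `v`, and the trace condition puts it in the field of `2 ^ m` elements. Then `y` and `v * y`
are distinct nonzero roots fixed by the `2 ^ m` power, so comparing their expansions in
`exists_root_pow_two_pow` kills the coefficient of the square. -/
theorem cubicPoly_eval_eq_zero_of_isAlgClosed {L : Type*} [Field L] [CharP L 2] [IsAlgClosed L]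
    {m : ℕ} {A y : L} (hA : A ≠ 0) (hy : y ^ 3 + y + A = 0) (hym : y ^ 2 ^ m = y)
    (htr : ∑ i ∈ Finset.range m, A⁻¹ ^ 2 ^ i = m) : (cubicPoly L m).eval A = 0 := by
  have h2 : (2 : L) = 0 := CharTwo.two_eq_zero
  have hy0 : y ≠ 0 := by
    rintro rfl
    exact hA (by simpa using hy)
  have hy1 : y + 1 ≠ 0 := by
    intro h
    apply hA
    linear_combination hy - (y ^ 2 - y + 2) * h + h2
  have hAy : A = y * (y + 1) ^ 2 := by
    linear_combination hy - (y ^ 3 + y ^ 2 + y) * h2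
  obtain ⟨v, hv⟩ : ∃ v : L, v ^ 2 + v = 1 + (y ^ 2)⁻¹ := by
    obtain ⟨v, hv⟩ := IsAlgClosed.exists_root (X ^ 2 + X + C (1 + (y ^ 2)⁻¹) : L[X])
      (by
        have : (X ^ 2 + X + C (1 + (y ^ 2)⁻¹) : L[X]).degree = 2 := by compute_degree!
        rw [this]; decide)
    refine ⟨v, CharTwo.add_eq_zero.mp ?_⟩
    simpa [IsRoot] using hv
  -- Since `1 / y ^ 2 + 1 / A = τ ^ 2 + τ` with `τ` in the subfield, `1 / y ^ 2` and `1 / A` have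
  -- the same trace.
  set τ : L := y⁻¹ + (y + 1)⁻¹ with hτ
  have hτm : τ ^ 2 ^ m = τ := by
    rw [hτ, add_pow_char_pow, inv_pow, inv_pow, add_pow_char_pow, hym, one_pow]
  have hvτ : v ^ 2 + v = (1 + A⁻¹) + (τ ^ 2 + τ) := by
    rw [hv, hτ, hAy]
    field_simp
    linear_combination -(y ^ 3 + 3 * y ^ 2 + 2 * y) * h2
  have hvm : v ^ 2 ^ m = v := by
    apply CharTwo.add_eq_zero.mp
    have hsplit (i : ℕ) : (1 + A⁻¹ + (τ ^ 2 + τ)) ^ 2 ^ i =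
        1 + A⁻¹ ^ 2 ^ i + (τ ^ 2 + τ) ^ 2 ^ i := by
      rw [add_pow_char_pow, add_pow_char_pow, one_pow]
    rw [← sum_sq_add_self_pow_two_pow, hvτ, Finset.sum_congr rfl fun i _ => hsplit i,
      Finset.sum_add_distrib, Finset.sum_add_distrib, htr, sum_sq_add_self_pow_two_pow, hτm]
    simp [CharTwo.add_self_eq_zero]
  obtain ⟨r, hr⟩ := exists_root_pow_two_pow A m
  have h₁ := hr y hy
  have hvy : y ^ 2 * (v ^ 2 + v) = y ^ 2 + 1 := by rw [hv]; field_simp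
  have h₂ := hr (v * y) (by
    linear_combination (v * y + y) * hvy + hy - (v ^ 2 * y ^ 3 - v * y) * h2)
  rw [mul_pow, hvm, hym] at h₂
  rw [hym] at h₁
  have hv0 : v ≠ 0 := by
    rintro rfl
    apply hy1
    have : (y + 1) ^ 2 = 0 := by linear_combination -hvy + y * h2
    exact pow_eq_zero_iff (two_ne_zero) |>.mp this
  have hv1 : v + 1 ≠ 0 := by
    intro h
    apply hy1
    have : (y + 1) ^ 2 = 0 := by linear_combination -hvy + y * h2 + y ^ 2 * v * h
    exact pow_eq_zero_iff (two_ne_zero) |>.mp this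
  have : (cubicPoly L m).eval A ^ 2 * (y ^ 2 * v * (v + 1)) = 0 := by
    linear_combination v * h₁ - h₂ + (cubicPoly L m).eval A ^ 2 * y ^ 2 * v * h2
  simpa [hy0, hv0, hv1] using this

/-- If `1 / A` and `1` have the same absolute trace over `𝔽_{2^m}` and `Y ^ 3 + Y + A` has a root
there, then it splits, and `cubicPoly` vanishes at `A`. -/
theorem cubicPoly_eval_eq_zero {L : Type*} [Field L] [CharP L 2]
    {m : ℕ} {A y : L} (hA : A ≠ 0) (hy : y ^ 3 + y + A = 0) (hym : y ^ 2 ^ m = y)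
    (htr : ∑ i ∈ Finset.range m, A⁻¹ ^ 2 ^ i = m) : (cubicPoly L m).eval A = 0 := by
  let f := algebraMap L (AlgebraicClosure L)
  have : CharP (AlgebraicClosure L) 2 := charP_of_injective_algebraMap f.injective 2
  apply f.injective
  rw [map_zero, ← eval_map_apply, cubicPoly_map]
  refine cubicPoly_eval_eq_zero_of_isAlgClosed (y := f y) ?_ ?_ ?_ ?_
  · simpa using hA
  · simpa using congrArg f hy
  · simpa using congrArg f hym
  · simpa using congrArg f htr

end Cubic

/-! ### Differences of solutions for the conjugation form -/

section Core

variable {L : Type*} [Field L] (σ ρ : L →+* L)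

/-- The map `u ↦ N(u + δ) ^ (1 / 4) * (u + δ)` for `u` fixed by the conjugation `σ`, with `N` the
norm and `ρ` the fourth root. -/
def normRootMul (δ u : L) : L := ρ ((u + δ) * (u + σ δ)) * (u + δ)

/-- The map `x ↦ x + N(x + σ x + δ) ^ (1 / 4) * (x + σ x + δ)`. -/
def conjPerm (δ x : L) : L := normRootMul σ ρ δ (x + σ x) + x

/-- The additive part of `u ↦ N(u + δ) ^ (1 / 4)`. -/
def normRootLin (δ u : L) : L := ρ u ^ 2 + ρ (δ + σ δ) * ρ u

/-- If `w` is the difference of two solutions of a `c`-differential equation for `conjPerm`, then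
`w` is the value of this map at `U = w + σ w`. -/
def solutionDiff (δ e u α U : L) : L :=
  e * (normRootLin σ ρ δ U * α + normRootLin σ ρ δ α * U)
    + normRootLin σ ρ δ U * (u + U + δ) + ρ ((u + δ) * (u + σ δ)) * U

variable {σ ρ}

theorem conj_comm_root [CharP L 2] (hρ : ∀ x, ρ x ^ 4 = x) (x : L) : σ (ρ x) = ρ (σ x) := by
  have h : σ (ρ x) ^ 4 = ρ (σ x) ^ 4 := by rw [hρ, ← map_pow, hρ]
  have h4 : (4 : ℕ) = 2 ^ 2 := rfl
  rw [h4] at h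
  exact iterateFrobenius_inj L 2 2 (by simpa [iterateFrobenius_def] using h)

theorem conj_normRootLin [CharP L 2] (hσ : ∀ x, σ (σ x) = x) (hρ : ∀ x, ρ x ^ 4 = x)
    (δ : L) {u : L} (hu : σ u = u) :
    σ (normRootLin σ ρ δ u) = normRootLin σ ρ δ u := by
  simp only [normRootLin, map_add, map_mul, map_pow, conj_comm_root hρ, hσ, hu]
  ring

/-- The cross term `2 * u * v` vanishes, so the norm changes by `v ^ 2 + (δ + σ δ) * v`,
independently of `u`. -/
theorem normRoot_add [CharP L 2] (δ u v : L) :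
    ρ ((u + v + δ) * (u + v + σ δ)) = ρ ((u + δ) * (u + σ δ)) + normRootLin σ ρ δ v := by
  have h2 : (2 : L) = 0 := CharTwo.two_eq_zero
  simp only [normRootLin, map_add, map_mul]
  linear_combination ρ u * ρ v * h2

theorem solutionDiff_add_conj [CharP L 2] (hσ : ∀ x, σ (σ x) = x) (hρ : ∀ x, ρ x ^ 4 = x)
    {δ e u α U : L} (hu : σ u = u) (hα : σ α = α) (hU : σ U = U) :
    solutionDiff σ ρ δ e u α U + σ (solutionDiff σ ρ δ e u α U) =
      (e + σ e) * normRootLin σ ρ δ α * U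
        + ((e + σ e) * α + (δ + σ δ)) * normRootLin σ ρ δ U := by
  have h2 : (2 : L) = 0 := CharTwo.two_eq_zero
  simp only [solutionDiff, map_add, map_mul, conj_comm_root hρ, hσ, hu, hα, hU,
    conj_normRootLin hσ hρ δ hα, conj_normRootLin hσ hρ δ hU]
  linear_combination (normRootLin σ ρ δ U * (u + U) + (ρ u + ρ δ) * (ρ u + ρ (σ δ)) * U) * h2

theorem normRootLin_add [CharP L 2] (δ u v : L) :
    normRootLin σ ρ δ (u + v) = normRootLin σ ρ δ u + normRootLin σ ρ δ v := by
  simp only [normRootLin, map_add]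
  linear_combination ρ u * ρ v * (CharTwo.two_eq_zero : (2 : L) = 0)

theorem cDerivative_conjPerm_add [CharP L 2] {δ c e a x w : L} (he : e * (1 + c) = 1) :
    e * (cDerivative (conjPerm σ ρ δ) c a (x + w) - cDerivative (conjPerm σ ρ δ) c a x) =
      w - solutionDiff σ ρ δ e (x + σ x) (a + σ a) (w + σ w) := by
  have h2 : (2 : L) = 0 := CharTwo.two_eq_zero
  have e₁ : x + w + a + σ (x + w + a) = (x + σ x) + ((w + σ w) + (a + σ a)) := by
    simp only [map_add]; ring
  have e₂ : x + a + σ (x + a) = (x + σ x) + (a + σ a) := by simp only [map_add]; ring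
  have e₃ : x + w + σ (x + w) = (x + σ x) + (w + σ w) := by simp only [map_add]; ring
  simp only [cDerivative, conjPerm, e₁, e₂, e₃]
  generalize x + σ x = u
  generalize w + σ w = U
  generalize a + σ a = α
  simp only [normRootMul, normRoot_add, solutionDiff, normRootLin_add]
  generalize ρ ((u + δ) * (u + σ δ)) = h
  generalize normRootLin σ ρ δ U = lU
  generalize normRootLin σ ρ δ α = lα
  have hc : e * c = 1 - e := by linear_combination he
  linear_combination (-(lU * (u + U + δ) + h * U + w)) * hc + (e * lU * (u + U + δ + α) + e * lα * U + h * U * e + w * e - w) * h2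

end Core

/-! ### Bounding the `c`-differential uniformity -/

section Uniformity

variable {L : Type*} [Field L] {F : L → L} {c : L}

theorem bddAbove_cDDT [Finite L] : BddAbove {k : ℕ | ∃ a b : L, (c = 1 → a ≠ 0) ∧ k = cDDT F c a b} := by
  refine ⟨Nat.card L, ?_⟩
  rintro k ⟨a, b, -, rfl⟩
  exact Finite.card_subtype_le _

theorem cDDT_le_cDifferentialUniformity [Finite L] (hc : c ≠ 1) (a b : L) :
    cDDT F c a b ≤ cDifferentialUniformity F c :=
  le_csSup bddAbove_cDDT ⟨a, b, fun h => absurd h hc, rfl⟩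

theorem cDifferentialUniformity_le {d : ℕ} (h : ∀ a b, cDDT F c a b ≤ d) :
    cDifferentialUniformity F c ≤ d := by
  refine csSup_le' ?_
  rintro k ⟨a, b, -, rfl⟩
  exact h a b

theorem isPcN_of_injective [Finite L] (hc : c ≠ 1)
    (h : ∀ a, Function.Injective (cDerivative F c a)) :
    IsPcN F c := by
  have hcard (a b : L) : cDDT F c a b ≤ 1 :=
    Finite.card_le_one_iff_subsingleton.mpr
      ⟨fun x y => Subtype.ext (h a (x.2.trans y.2.symm))⟩
  refine le_antisymm (cDifferentialUniformity_le hcard) ?_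
  refine le_trans ?_ (cDDT_le_cDifferentialUniformity hc 0 (cDerivative F c 0 0))
  have : Nonempty {x // cDerivative F c 0 x = cDerivative F c 0 0} := ⟨0, rfl⟩
  exact Nat.card_pos

theorem two_le_cDDT [Finite L] {a x y : L} (hxy : x ≠ y) (h : cDerivative F c a x = cDerivative F c a y) :
    2 ≤ cDDT F c a (cDerivative F c a y) := by
  have : Nontrivial {z // cDerivative F c a z = cDerivative F c a y} :=
    ⟨⟨x, h⟩, ⟨y, rfl⟩, fun e => hxy (congrArg Subtype.val e)⟩
  exact Finite.one_lt_card

/-- Fix one solution and send each solution to its difference `w` from it. The polynomial must not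
depend on the base point, and `f` need only be injective on such differences. -/
theorem cDDT_le_of_roots [Finite L] {a b : L} {d : ℕ} {p : L[X]} (hp : p ≠ 0) (hd : p.natDegree ≤ d)
    (f : L → L)
    (hf : ∀ x w, cDerivative F c a (x + w) = cDerivative F c a x → p.eval (f w) = 0)
    (hinj : ∀ x w w', cDerivative F c a (x + w) = cDerivative F c a x →
      cDerivative F c a (x + w') = cDerivative F c a x → f w = f w' → w = w') :
    cDDT F c a b ≤ d := by
  classical
  rcases isEmpty_or_nonempty {x // cDerivative F c a x = b} with h | ⟨⟨x₀, hx₀⟩⟩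
  · simp [cDDT]
  have hx (x : {x // cDerivative F c a x = b}) :
      cDerivative F c a (x₀ + (x - x₀)) = cDerivative F c a x₀ := by
    rw [add_sub_cancel, x.2, hx₀]
  let g : {x // cDerivative F c a x = b} → p.roots.toFinset := fun x =>
    ⟨f (x - x₀), by simpa [hp] using hf _ _ (hx x)⟩
  have hg : Function.Injective g := fun x y hxy =>
    Subtype.ext (sub_left_injective (hinj x₀ _ _ (hx x) (hx y) (congrArg Subtype.val hxy)))
  calc cDDT F c a b ≤ Nat.card p.roots.toFinset := Nat.card_le_card_of_injective g hg
    _ = p.roots.toFinset.card := by rw [Nat.card_eq_fintype_card, Fintype.card_coe]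
    _ ≤ p.natDegree := (Multiset.toFinset_card_le _).trans p.card_roots'
    _ ≤ d := hd

end Uniformity

/-! ### Uniformity bounds for `conjPerm` -/

section ConjPerm

variable {L : Type*} [Field L] {σ ρ : L →+* L}

theorem conj_add_self_conj (hσ : ∀ x, σ (σ x) = x) (x : L) : σ (x + σ x) = x + σ x := by
  rw [map_add, hσ, add_comm]

variable [CharP L 2]

theorem add_ne_zero_of_ne_one {c : L} (hc : c ≠ 1) : 1 + c ≠ 0 := fun h =>
  hc (CharTwo.add_eq_zero.mp h).symm

theorem cDerivative_conjPerm_add_eq_iff {δ c : L} (hc : c ≠ 1) (a x w : L) :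
    cDerivative (conjPerm σ ρ δ) c a (x + w) = cDerivative (conjPerm σ ρ δ) c a x ↔
      w = solutionDiff σ ρ δ (1 + c)⁻¹ (x + σ x) (a + σ a) (w + σ w) := by
  have hc' := add_ne_zero_of_ne_one hc
  rw [← sub_eq_zero, ← sub_eq_zero (a := w), ← cDerivative_conjPerm_add (inv_mul_cancel₀ hc')]
  simp [hc']

/-- The trace of a difference of two solutions is annihilated by a linearized polynomial. -/
theorem linearized_eq_zero (hσ : ∀ x, σ (σ x) = x) (hρ : ∀ x, ρ x ^ 4 = x) {δ c : L} (hc : c ≠ 1)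
    {a x w : L}
    (h : cDerivative (conjPerm σ ρ δ) c a (x + w) = cDerivative (conjPerm σ ρ δ) c a x) :
    (1 + ((1 + c)⁻¹ + σ (1 + c)⁻¹) * normRootLin σ ρ δ (a + σ a)) * ρ (w + σ w) ^ 4 +
      (((1 + c)⁻¹ + σ (1 + c)⁻¹) * (a + σ a) + (δ + σ δ)) * ρ (w + σ w) ^ 2 +
      (((1 + c)⁻¹ + σ (1 + c)⁻¹) * (a + σ a) + (δ + σ δ)) * ρ (δ + σ δ) * ρ (w + σ w) = 0 := by
  rw [cDerivative_conjPerm_add_eq_iff hc] at h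
  have h' := solutionDiff_add_conj hσ hρ (δ := δ) (e := (1 + c)⁻¹) (conj_add_self_conj hσ x)
    (conj_add_self_conj hσ a) (conj_add_self_conj hσ w)
  rw [← h] at h'
  rw [hρ]
  have hl : normRootLin σ ρ δ (w + σ w) =
    ρ (w + σ w) ^ 2 + ρ (δ + σ δ) * ρ (w + σ w) := rfl
  rw [hl] at h'
  linear_combination h' + (((1 + c)⁻¹ + σ (1 + c)⁻¹) * normRootLin σ ρ δ (a + σ a) * (w + σ w) +
    (((1 + c)⁻¹ + σ (1 + c)⁻¹) * (a + σ a) + (δ + σ δ)) *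
      (ρ (w + σ w) ^ 2 + ρ (δ + σ δ) * ρ (w + σ w))) * (CharTwo.two_eq_zero : (2 : L) = 0)

/-- The difference `w` is recovered from `w + σ w` through `solutionDiff`, and `ρ` is injective. -/
theorem eq_of_root_trace_eq {δ c : L} (hc : c ≠ 1) {a x w w' : L}
    (h : cDerivative (conjPerm σ ρ δ) c a (x + w) = cDerivative (conjPerm σ ρ δ) c a x)
    (h' : cDerivative (conjPerm σ ρ δ) c a (x + w') = cDerivative (conjPerm σ ρ δ) c a x)
    (hw : ρ (w + σ w) = ρ (w' + σ w')) : w = w' := by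
  rw [cDerivative_conjPerm_add_eq_iff hc] at h h'
  rw [h, h', ρ.injective hw]

theorem inv_add_conj_inv_eq_zero_iff {c : L} :
    (1 + c)⁻¹ + σ (1 + c)⁻¹ = 0 ↔ σ c = c := by
  rw [CharTwo.add_eq_zero, map_inv₀, inv_inj, map_add, map_one, add_right_inj, eq_comm]

theorem conjPerm_isPcN [Finite L] (hσ : ∀ x, σ (σ x) = x) (hρ : ∀ x, ρ x ^ 4 = x) {δ c : L}
    (hδ : ∀ z, σ z = z → z ^ 4 + (δ + σ δ) * z ^ 2 + (δ + σ δ) * ρ (δ + σ δ) * z = 0 → z = 0)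
    (hc : c ≠ 1) (hσc : σ c = c) : IsPcN (conjPerm σ ρ δ) c := by
  refine isPcN_of_injective hc fun a x y hxy => ?_
  have h : cDerivative (conjPerm σ ρ δ) c a (y + (x - y)) = cDerivative (conjPerm σ ρ δ) c a y := by
    rw [add_sub_cancel, hxy]
  have hz := linearized_eq_zero hσ hρ hc h
  simp only [inv_add_conj_inv_eq_zero_iff.mpr hσc, zero_mul, zero_add, add_zero, one_mul] at hz
  have h0 := hδ _ (by rw [conj_comm_root hρ, conj_add_self_conj hσ]) hz
  exact sub_eq_zero.mp (eq_of_root_trace_eq (w' := 0) hc h (by rw [add_zero])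
    (by rw [h0, map_zero, add_zero, map_zero]))

theorem conjPerm_cDifferentialUniformity_le_four [Finite L] (hσ : ∀ x, σ (σ x) = x)
    (hρ : ∀ x, ρ x ^ 4 = x) {δ c : L}
    (hδ : ∀ z, σ z = z → z ^ 4 + (δ + σ δ) * z ^ 2 + (δ + σ δ) * ρ (δ + σ δ) * z = 0 → z = 0)
    (hc : c ≠ 1) : cDifferentialUniformity (conjPerm σ ρ δ) c ≤ 4 := by
  refine cDifferentialUniformity_le fun a b => ?_
  set s := (1 + c)⁻¹ + σ (1 + c)⁻¹ with hs
  set k₄ := 1 + s * normRootLin σ ρ δ (a + σ a) with hk₄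
  set k₂ := s * (a + σ a) + (δ + σ δ) with hk₂
  let p : L[X] := C k₄ * X ^ 4 + C k₂ * X ^ 2 + C (k₂ * ρ (δ + σ δ)) * X
  have hp : p ≠ 0 := by
    intro h
    have h₄ : k₄ = 0 := by simpa [p, coeff_X, coeff_C] using congrArg (coeff · 4) h
    have h₂ : k₂ = 0 := by simpa [p, coeff_X, coeff_C] using congrArg (coeff · 2) h
    -- With `α = a + σ a` and `T = δ + σ δ`, vanishing coefficients give `s * α = T` and `s *
    -- normRootLin σ ρ δ α = 1`. Hence `α = T * normRootLin σ ρ δ α`, so `ρ α` is a root of the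
    -- polynomial in `hδ`.
    have h0 : ρ (a + σ a) = 0 := by
      refine hδ _ (by rw [conj_comm_root hρ, conj_add_self_conj hσ]) ?_
      rw [hρ]
      rw [hk₄, normRootLin] at h₄
      linear_combination (a + σ a) * h₄ +
        (- ρ (a + σ a) ^ 2 - ρ (δ + σ δ) * ρ (a + σ a)) * (h₂ - (δ + σ δ) * (CharTwo.two_eq_zero : (2 : L) = 0))
    rw [hk₄, normRootLin, h0] at h₄
    simp at h₄
  have hd : p.natDegree ≤ 4 := by simp only [p]; compute_degree
  exact cDDT_le_of_roots hp hd (fun w => ρ (w + σ w))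
    (fun x w h => by
      have := linearized_eq_zero hσ hρ hc h
      rw [← hs, ← hk₄, ← hk₂] at this
      simpa only [p, eval_add, eval_mul, eval_C, eval_pow, eval_X] using this)
    fun x w w' h h' => eq_of_root_trace_eq hc h h'

theorem conjPerm_cDifferentialUniformity_le_two [Finite L] (hσ : ∀ x, σ (σ x) = x)
    (hρ : ∀ x, ρ x ^ 4 = x) {δ c : L} (hδ : σ δ = δ) (hσc : σ c ≠ c) :
    cDifferentialUniformity (conjPerm σ ρ δ) c ≤ 2 := by
  have hc : c ≠ 1 := fun h => hσc (by rw [h, map_one])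
  have hT : δ + σ δ = 0 := by rw [hδ, CharTwo.add_self_eq_zero]
  refine cDifferentialUniformity_le fun a b => ?_
  set s := (1 + c)⁻¹ + σ (1 + c)⁻¹ with hs
  have hs0 : s ≠ 0 := inv_add_conj_inv_eq_zero_iff.not.mpr hσc
  -- For `T = 0` the linearized polynomial is quadratic in `z ^ 2`, and squaring is injective.
  let p : L[X] := C (1 + s * ρ (a + σ a) ^ 2) * X ^ 2 + C (s * (a + σ a)) * X
  have hp : p ≠ 0 := by
    intro h
    have h₂ : 1 + s * ρ (a + σ a) ^ 2 = 0 := by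
      simpa only [p, coeff_add, coeff_C_mul, coeff_X_pow, coeff_X, coeff_zero, mul_one,
        OfNat.one_ne_ofNat, if_true, if_false, mul_zero, add_zero] using congrArg (coeff · 2) h
    have h₁ : s * (a + σ a) = 0 := by
      simpa only [p, coeff_add, coeff_C_mul, coeff_X_pow, coeff_X_one, coeff_zero, mul_one,
        OfNat.one_ne_ofNat, if_false, mul_zero, zero_add] using congrArg (coeff · 1) h
    rw [(mul_eq_zero.mp h₁).resolve_left hs0] at h₂
    simp at h₂
  have hd : p.natDegree ≤ 2 := by simp only [p]; compute_degree
  refine cDDT_le_of_roots hp hd (fun w => ρ (w + σ w) ^ 2) (fun x w h => ?_)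
    fun x w w' h h' hw => eq_of_root_trace_eq hc h h' (frobenius_inj L 2 hw)
  have := linearized_eq_zero hσ hρ hc h
  rw [normRootLin, hT, map_zero, ← hs] at this
  simp only [p, eval_add, eval_mul, eval_C, eval_pow, eval_X]
  linear_combination this

theorem two_le_conjPerm_cDifferentialUniformity [Finite L] (hσ : ∀ x, σ (σ x) = x)
    (hρ : ∀ x, ρ x ^ 4 = x) {δ c κ : L} (hδ : σ δ = δ) (hσc : σ c ≠ c)
    (hκ : σ κ = κ) (hκ0 : κ ≠ 0) (hκ1 : κ ≠ 1) :
    2 ≤ cDifferentialUniformity (conjPerm σ ρ δ) c := by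
  have h2 : (2 : L) = 0 := CharTwo.two_eq_zero
  have hc : c ≠ 1 := fun h => hσc (by rw [h, map_one])
  have hT : δ + σ δ = 0 := by rw [hδ, CharTwo.add_self_eq_zero]
  set e := (1 + c)⁻¹ with he
  set s := e + σ e with hs
  have hs0 : s ≠ 0 := inv_add_conj_inv_eq_zero_iff.not.mpr hσc
  have hσs : σ s = s := conj_add_self_conj hσ e
  -- The second expression vanishes for at most one value of `a + σ a`, so one of the candidates
  -- `c`, `κ * c` works.
  obtain ⟨a, ha, ha'⟩ : ∃ a, a + σ a ≠ 0 ∧ 1 + s * ρ (a + σ a) ^ 2 ≠ 0 := by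
    have hr : c + σ c ≠ 0 := fun h => hσc (CharTwo.add_eq_zero.mp h).symm
    by_cases h : 1 + s * ρ (c + σ c) ^ 2 = 0
    · have hκc : κ * c + σ (κ * c) = κ * (c + σ c) := by rw [map_mul, hκ, mul_add]
      refine ⟨κ * c, by rw [hκc]; exact mul_ne_zero hκ0 hr, fun h' => hκ1 ?_⟩
      rw [hκc] at h'
      have : ρ (κ * (c + σ c)) ^ 2 = ρ (c + σ c) ^ 2 :=
        mul_left_cancel₀ hs0 (by linear_combination h' - h)
      have := ρ.injective (frobenius_inj L 2 this)
      exact mul_right_cancel₀ hr (by rw [this, one_mul])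
    · exact ⟨c, hr, h⟩
  set α := a + σ a with hα
  have hσα : σ α = α := conj_add_self_conj hσ a
  -- This is the nonzero root `z ^ 2` of the quadratic; as `U = z ^ 4`, the trace of the difference
  -- has to be `v ^ 2`.
  set v := s * α / (1 + s * ρ α ^ 2) with hv
  have hv0 : v ≠ 0 := div_ne_zero (mul_ne_zero hs0 ha) ha'
  have hσv : σ v = v := by
    simp only [hv, map_div₀, map_mul, map_add, map_one, map_pow, conj_comm_root hρ, hσs, hσα]
  have hvl : (1 + s * ρ α ^ 2) * v = s * α := by rw [hv]; field_simp
  have hσU : σ (v ^ 2) = v ^ 2 := by rw [map_pow, hσv]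
  have hW := solutionDiff_add_conj hσ hρ (δ := δ) (e := e) (map_zero σ) hσα hσU
  set w := solutionDiff σ ρ δ e 0 α (v ^ 2) with hw
  have hww : w + σ w = v ^ 2 := by
    have hρv : ρ (v ^ 2) ^ 2 = v := by rw [map_pow, ← pow_mul, hρ]
    rw [hW, normRootLin, normRootLin, hT, map_zero, ← hs, hρv]
    linear_combination v * hvl - v ^ 2 * h2 + s * α * v * h2
  have hD := (cDerivative_conjPerm_add_eq_iff (σ := σ) (ρ := ρ) (δ := δ) hc a 0 w).mpr (by
    rw [hww, map_zero, add_zero])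
  rw [zero_add] at hD
  have hw0 : w ≠ 0 := by
    intro h
    rw [h, map_zero, add_zero] at hww
    exact hv0 (pow_eq_zero_iff (two_ne_zero) |>.mp hww.symm)
  exact (two_le_cDDT hw0 hD).trans (cDDT_le_cDifferentialUniformity hc _ _)

end ConjPerm

/-! ### Subfields and traces of finite fields -/

section FiniteField

theorem IntermediateField.mem_iff_pow_card_eq {k L : Type*} [Field k] [Field L] [Finite L]
    [Algebra k L] (K : IntermediateField k L) {x : L} : x ∈ K ↔ x ^ Nat.card K = x := by
  classical
  have := Fintype.ofFinite L
  have := Fintype.ofFinite K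
  have hK : 1 < Nat.card K := Finite.one_lt_card
  have hfix (y : K) : (y : L) ^ Nat.card K = y := by
    rw [Nat.card_eq_fintype_card]
    exact congrArg Subtype.val (FiniteField.pow_card y)
  refine ⟨fun hx => hfix ⟨x, hx⟩, fun hx => ?_⟩
  by_contra hxK
  have hp := FiniteField.X_pow_card_sub_X_ne_zero L hK
  have hle := card_le_degree_of_subset_roots (p := (X ^ Nat.card K - X : L[X]))
    (Z := insert x (K : Set L).toFinset) (by
      intro y hy
      have hy' : y ∈ insert x (K : Set L).toFinset := hy
      rw [Finset.mem_insert, Set.mem_toFinset] at hy'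
      rw [mem_roots hp, IsRoot, eval_sub, eval_pow, eval_X, sub_eq_zero]
      rcases hy' with rfl | hy'
      · exact hx
      · exact hfix ⟨y, hy'⟩)
  rw [Finset.card_insert_of_notMem (by simpa using hxK), Set.toFinset_card,
    FiniteField.X_pow_card_sub_X_natDegree_eq L hK, Nat.card_eq_fintype_card] at hle
  exact absurd hle (by simp)

theorem finrank_zmod_two_eq {L : Type*} [Field L] [Finite L] [Algebra (ZMod 2) L] {n : ℕ}
    (h : Nat.card L = 2 ^ n) : Module.finrank (ZMod 2) L = n := by
  have := Module.natCard_eq_pow_finrank (K := ZMod 2) (V := L)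
  rw [h, Nat.card_zmod] at this
  exact (Nat.pow_right_injective le_rfl this).symm

/-- Pairing the terms of index `i` and `m + i` is transitivity of the trace through the subfield. -/
theorem algebraMap_trace_eq_sum_two_pow {L : Type*} [Field L] [Finite L] [Algebra (ZMod 2) L]
    {m : ℕ} (h : Nat.card L = 2 ^ (2 * m)) [CharP L 2] (x : L) :
    algebraMap (ZMod 2) L (Algebra.trace (ZMod 2) L x) =
      ∑ i ∈ Finset.range m, (x + x ^ 2 ^ m) ^ 2 ^ i := by
  rw [FiniteField.algebraMap_trace_eq_sum_pow, finrank_zmod_two_eq h, Nat.card_zmod, two_mul,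
    Finset.sum_range_add, ← Finset.sum_add_distrib]
  refine Finset.sum_congr rfl fun i _ => ?_
  rw [add_pow_char_pow, ← pow_mul, ← pow_add]

theorem trace_zmod_two_one {K : Type*} [Field K] [Finite K] [Algebra (ZMod 2) K] {m : ℕ}
    (h : Nat.card K = 2 ^ m) : Algebra.trace (ZMod 2) K 1 = m := by
  rw [← map_one (algebraMap (ZMod 2) K), Algebra.trace_algebraMap, finrank_zmod_two_eq h,
    nsmul_eq_mul, mul_one]

end FiniteField

/-- Exponents of Frobenius count modulo `2 * m`, so the power `2 ^ (m - 2)` is `ρ` after `σ`. -/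
theorem permPoly_eval_eq_conjPerm {L : Type*} [Field L] [CharP L 2] {m : ℕ} (hm : 2 ≤ m)
    (hL : ∀ x : L, x ^ 2 ^ (2 * m) = x) (δ : L) :
    (fun x => (permPoly m δ).eval x) =
      conjPerm (iterateFrobenius L 2 m) (iterateFrobenius L 2 (2 * m - 2)) δ := by
  funext x
  have hy : x ^ 2 ^ m + x + iterateFrobenius L 2 m δ =
      iterateFrobenius L 2 m (x ^ 2 ^ m + x + δ) := by
    have : (x ^ 2 ^ m) ^ 2 ^ m = x := by rw [← pow_mul, ← pow_add, ← two_mul, hL]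
    simp only [map_add, iterateFrobenius_def, this]
    ring
  simp only [permPoly, conjPerm, normRootMul, eval_add, eval_pow, eval_X, eval_C]
  rw [add_comm x, iterateFrobenius_def 2 m x, hy]
  generalize x ^ 2 ^ m + x + δ = y
  have h₁ : (y ^ 2 ^ m) ^ 2 ^ (2 * m - 2) = y ^ 2 ^ (m - 2) := by
    rw [← pow_mul, ← pow_add, show m + (2 * m - 2) = 2 * m + (m - 2) by omega, pow_add, pow_mul, hL]
  rw [map_mul]
  simp only [iterateFrobenius_def, h₁]
  ring

/-- The linearized polynomial controlling `permPoly` has no nonzero root in the subfield. -/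
theorem linearized_root_eq_zero {L : Type*} [Field L] [CharP L 2] {m : ℕ} {T t z : L}
    (hT : T ≠ 0) (ht : t ^ 4 = T) (htm : t ^ 2 ^ m = t)
    (htr : ∑ i ∈ Finset.range m, T ^ 2 ^ i = m) (hp : (cubicPoly L m).eval T⁻¹ ≠ 0)
    (hzm : z ^ 2 ^ m = z) (hz : z ^ 4 + T * z ^ 2 + T * t * z = 0) : z = 0 := by
  by_contra hz0
  have ht0 : t ≠ 0 := by
    rintro rfl
    exact hT (by simpa using ht.symm)
  -- Dividing by `z` and substituting `z = t ^ 2 * y` turns the equation into `y ^ 3 + y + t⁻¹ = 0`;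
  -- its fourth power has constant term `T⁻¹`.
  refine hp (cubicPoly_eval_eq_zero (y := (z / t ^ 2) ^ 4) (inv_ne_zero hT) ?_ ?_ ?_)
  · have hz3 : z ^ 3 + t ^ 4 * z + t ^ 5 = 0 := by
      rw [← ht] at hz
      exact mul_left_cancel₀ hz0 (by linear_combination hz)
    have hy : (z / t ^ 2) ^ 3 + z / t ^ 2 + t⁻¹ = 0 := by
      field_simp
      linear_combination hz3
    have h4 (a b : L) : (a + b) ^ 4 = a ^ 4 + b ^ 4 := add_pow_char_pow a b 2 2
    have := congrArg (· ^ 4) hy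
    simp only [h4] at this
    rw [← ht]
    linear_combination this
  · rw [← pow_mul, mul_comm 4, pow_mul, div_pow, hzm, ← pow_mul, mul_comm 2, pow_mul, htm]
  · simpa using htr

theorem theorem1 (m : ℕ) (hm : 2 ≤ m)
    {L : Type*} [Field L] [Finite L] [Algebra (ZMod 2) L] (hL : Nat.card L = 2 ^ (2 * m))
    (K : IntermediateField (ZMod 2) L) (hK : Nat.card K = 2 ^ m) (δ : L) :
    (δ ∈ K →
      (∀ c : L, c ∈ K → c ≠ 1 → IsPcN (fun x => (permPoly m δ).eval x) c) ∧
      (∀ c : L, c ∉ K → IsAPcN (fun x => (permPoly m δ).eval x) c)) ∧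
    (δ ∉ K →
      Algebra.trace (ZMod 2) L δ = Algebra.trace (ZMod 2) K 1 →
      (cubicPoly L m).eval ((δ + δ ^ (2 ^ m))⁻¹) ≠ 0 →
      (∀ c : L, c ∈ K → c ≠ 1 → IsPcN (fun x => (permPoly m δ).eval x) c) ∧
      (∀ c : L, c ∉ K → cDifferentialUniformity (fun x => (permPoly m δ).eval x) c ≤ 4)) := by
  have : CharP L 2 := charP_of_injective_algebraMap (algebraMap (ZMod 2) L).injective 2
  have hLpow (x : L) : x ^ 2 ^ (2 * m) = x := by
    have := Fintype.ofFinite L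
    rw [← hL, Nat.card_eq_fintype_card, FiniteField.pow_card]
  rw [permPoly_eval_eq_conjPerm hm hLpow]
  set σ := iterateFrobenius L 2 m with hσdef
  set ρ := iterateFrobenius L 2 (2 * m - 2) with hρdef
  have hσ (x : L) : σ (σ x) = x := by
    simp only [hσdef, iterateFrobenius_def]
    rw [← pow_mul, ← pow_add, ← two_mul, hLpow]
  have hρ (x : L) : ρ x ^ 4 = x := by
    rw [hρdef, iterateFrobenius_def, ← pow_mul, show 4 = 2 ^ 2 from rfl, ← pow_add,
      Nat.sub_add_cancel (by omega), hLpow]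
  have hKσ (x : L) : x ∈ K ↔ σ x = x := by
    rw [K.mem_iff_pow_card_eq, hK, hσdef, iterateFrobenius_def]
  have hσpow (x : L) : x ^ 2 ^ m = σ x := (iterateFrobenius_def 2 m x).symm
  simp only [hKσ]
  constructor
  · intro hδ
    have hT : δ + σ δ = 0 := by rw [hδ, CharTwo.add_self_eq_zero]
    -- Here `2 ≤ m` matters: the subfield has at least four elements.
    obtain ⟨κ, hκ0, hκ1⟩ : ∃ κ : K, κ ≠ 0 ∧ κ ≠ 1 := by
      by_contra! h
      have hle : Nat.card K ≤ 2 := by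
        have hsurj : Function.Surjective (fun b : Bool => if b then (1 : K) else 0) := fun x => by
          by_cases hx : x = 0
          · exact ⟨false, by simp [hx]⟩
          · exact ⟨true, by simp [h x hx]⟩
        simpa using Nat.card_le_card_of_surjective _ hsurj
      have : 2 ^ 2 ≤ 2 ^ m := Nat.pow_le_pow_right two_pos hm
      omega
    refine ⟨fun c hc hc1 => conjPerm_isPcN hσ hρ (fun z _ hz => ?_) hc1 hc, fun c hc => ?_⟩
    · simpa [hT] using hz
    · exact le_antisymm (conjPerm_cDifferentialUniformity_le_two hσ hρ hδ hc)
        (two_le_conjPerm_cDifferentialUniformity hσ hρ hδ hc ((hKσ κ).mp κ.2)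
          (by simpa using hκ0) (by simpa using hκ1))
  · intro hδ htr hp
    have hT : δ + σ δ ≠ 0 := fun h => hδ (CharTwo.add_eq_zero.mp h).symm
    have htr' : ∑ i ∈ Finset.range m, (δ + σ δ) ^ 2 ^ i = (m : L) := by
      rw [← hσpow, ← algebraMap_trace_eq_sum_two_pow hL, htr, trace_zmod_two_one hK, map_natCast]
    rw [hσpow] at hp
    have hroot (z : L) (hσz : σ z = z)
        (hz : z ^ 4 + (δ + σ δ) * z ^ 2 + (δ + σ δ) * ρ (δ + σ δ) * z = 0) : z = 0 :=
      linearized_root_eq_zero hT (hρ _)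
        (by rw [hσpow, conj_comm_root hρ, conj_add_self_conj hσ]) htr' hp
        (by rw [hσpow, hσz]) hz
    exact ⟨fun c hc hc1 => conjPerm_isPcN hσ hρ hroot hc1 hc,
      fun c hc => conjPerm_cDifferentialUniformity_le_four hσ hρ hroot
        fun h => hc (by rw [h, map_one])⟩
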